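/- **Proposition 5.2.** Let $K$ be a field. All graphs are row-finite directed graphs $E=(E^0,E^1,r,s)$, that is, $s^{-1}(v)$ is finite for every $v\in E^0$, and $L_K(E)$ is the Leavitt path algebra of $E$. A set $X\subseteq E^0$ is *hereditary* if it contains the range of every path whose source lies in $X$, and *saturated* if $v\in X$ whenever $s^{-1}(v)\neq\emptyset$ and $r(s^{-1}(v))\subseteq X$. Write $I(X)$ for the two-sided ideal of $L_K(E)$ generated by $X$ and, for $X$ hereditary, $E/X$ for the graph with vertex set $E^0\setminus X$ and edge set $\{e\in E^1: r(e)\notin X\}$. For $X$ hereditary and saturated let $\theta_X\colon L_K(E)/I(X)\to L_K(E/X)$ be the canonical homomorphism induced by the map $L_K(E)\to L_K(E/X)$ that fixes the vertices, edges and ghost edges surviving in $E/X$ and sends the other ones to $0$. A *point functor* $H$ is a subfunctor of the functor $E\mapsto E^0$ on the category of graphs and graph isomorphisms, with values in sets; it is *hereditary saturated* if $H(E)$ is hereditary and saturated for every $E$, and *invariant under isomorphism* if $f(I(H(E)))=I(H(F))$ for all graphs $E,F$ and every ring isomorphism $f\colon L_K(E)\to L_K(F)$. Let $H$ be a hereditary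 saturated point functor. Then there is exactly one sequence $(H^{(n)})_{n\ge 1}$ of hereditary saturated point functors such that $H^{(1)}=H$ and, for all $n\ge 1$ and all $E$, $I(H^{(n)}(E))\subseteq I(H^{(n+1)}(E))$ and $$\theta_{H^{(n)}(E)}\!\left(\frac{I(H^{(n+1)}(E))}{I(H^{(n)}(E))}\right)=I\!\left(H\big(E/H^{(n)}(E)\big)\right).$$ For this sequence all the maps $\theta_{H^{(n)}(E)}$ are bijective (so $L_K(E)/I(H^{(n)}(E))\cong L_K(E/H^{(n)}(E))$), and $H=H^{(1)}\subseteq H^{(2)}\subseteq\cdots$. Moreover, if $H$ is invariant under isomorphism, then $H^{(n)}$ is invariant under isomorphism for every $n\ge 1$. -/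

import Mathlib

open CategoryTheory

universe u v w

noncomputable section

/-! ### Row-finite directed graphs -/

/-- A row-finite directed graph `E = (E⁰, E¹, r, s)`: every vertex emits only finitely many
edges. -/
structure RowFiniteGraph : Type (max (u + 1) (v + 1)) where
  /-- the set `E⁰` of vertices -/
  Vertex : Type u
  /-- the set `E¹` of edges -/
  Edge : Type v
  /-- source -/
  s : Edge → Vertex
  /-- range (target) -/
  r : Edge → Vertex
  rowFinite : ∀ x : Vertex, (s ⁻¹' {x}).Finite

namespace RowFiniteGraph

/-- Isomorphisms of directed graphs. -/
@[ext]
structure GraphIso (E F : RowFiniteGraph.{u, v}) where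
  vertexEquiv : E.Vertex ≃ F.Vertex
  edgeEquiv : E.Edge ≃ F.Edge
  map_s : ∀ e, F.s (edgeEquiv e) = vertexEquiv (E.s e)
  map_r : ∀ e, F.r (edgeEquiv e) = vertexEquiv (E.r e)

/-- The category of (row-finite) directed graphs; its morphisms are the graph isomorphisms. -/
instance : Category RowFiniteGraph.{u, v} where
  Hom := GraphIso
  id E := ⟨Equiv.refl _, Equiv.refl _, fun _ => rfl, fun _ => rfl⟩
  comp α β := ⟨α.vertexEquiv.trans β.vertexEquiv, α.edgeEquiv.trans β.edgeEquiv,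
    fun e => by simp [α.map_s, β.map_s], fun e => by simp [α.map_r, β.map_r]⟩

/-- The functor `E ↦ E⁰`. -/
def vertexFunctor : RowFiniteGraph.{u, v} ⥤ Type u where
  obj E := E.Vertex
  map α := TypeCat.ofHom (GraphIso.vertexEquiv α)

variable (E : RowFiniteGraph.{u, v})

/-- `x ≥ y`: there is a (possibly trivial) path from `x` to `y`. -/
def Reaches (x y : E.Vertex) : Prop :=
  Relation.ReflTransGen (fun a b => ∃ e : E.Edge, E.s e = a ∧ E.r e = b) x y

/-- A set of vertices is hereditary if it contains every vertex reached from one of its members. -/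
def IsHereditary (X : Set E.Vertex) : Prop :=
  ∀ x ∈ X, ∀ y, E.Reaches x y → y ∈ X

/-- A regular vertex: not a sink (and not an infinite emitter, which is automatic here since
graphs are row-finite). -/
def IsRegular (x : E.Vertex) : Prop := ∃ e : E.Edge, E.s e = x

/-- A set of vertices is saturated if it contains every regular vertex all of whose emitted edges
have range in the set. -/
def IsSaturated (X : Set E.Vertex) : Prop :=
  ∀ x, E.IsRegular x → (∀ e : E.Edge, E.s e = x → E.r e ∈ X) → x ∈ X

variable {E} in
theorem IsHereditary.r_mem {X : Set E.Vertex} (hX : E.IsHereditary X) {e : E.Edge}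
    (he : E.s e ∈ X) : E.r e ∈ X :=
  hX _ he _ (Relation.ReflTransGen.single ⟨e, rfl, rfl⟩)

/-- The quotient graph `E / X`: its vertices are the vertices outside `X`, its edges are the edges
whose range is outside `X`. (When `X` is hereditary the source of such an edge is outside `X` too;
this is recorded in the definition of the edge set so that it makes sense for every `X`.) -/
def quotient (X : Set E.Vertex) : RowFiniteGraph.{u, v} where
  Vertex := {x : E.Vertex // x ∉ X}
  Edge := {e : E.Edge // E.s e ∉ X ∧ E.r e ∉ X}
  s e := ⟨E.s e.1, e.2.1⟩
  r e := ⟨E.r e.1, e.2.2⟩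
  rowFinite x := by
    refine Set.Finite.of_finite_image ((E.rowFinite x.1).subset ?_) Subtype.val_injective.injOn
    rintro _ ⟨e, he, rfl⟩
    exact congrArg Subtype.val he

end RowFiniteGraph

/-! ### Leavitt path algebras -/

/-- The generators of the Leavitt path algebra: the vertices `x`, the edges `e` and the ghost
edges `e*`. -/
inductive LeavittGen (E : RowFiniteGraph.{u, v}) : Type (max u v)
  | vertex (x : E.Vertex)
  | edge (e : E.Edge)
  | ghost (e : E.Edge)

/-- The free (associative, not necessarily unital) `K`-algebra on the generators. -/
abbrev LeavittFree (K : Type w) [Field K] (E : RowFiniteGraph.{u, v}) : Type (max u v w) :=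
  MonoidAlgebra K (FreeSemigroup (LeavittGen E))

namespace LeavittFree

variable (K : Type w) [Field K] {E : RowFiniteGraph.{u, v}}

/-- A generator as an element of the free algebra. -/
def gen (g : LeavittGen E) : LeavittFree K E := MonoidAlgebra.single (FreeSemigroup.of g) 1

/-- A vertex as an element of the free algebra. -/
abbrev vertex (x : E.Vertex) : LeavittFree K E := gen K (.vertex x)

/-- An edge as an element of the free algebra. -/
abbrev edge (e : E.Edge) : LeavittFree K E := gen K (.edge e)

/-- A ghost edge as an element of the free algebra. -/
abbrev ghost (e : E.Edge) : LeavittFree K E := gen K (.ghost e)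

/-- The defining relations of the Leavitt path algebra. -/
inductive Rel : LeavittFree K E → LeavittFree K E → Prop
  | vertex_mul_self (x : E.Vertex) : Rel (vertex K x * vertex K x) (vertex K x)
  | vertex_mul_of_ne (x y : E.Vertex) (h : x ≠ y) : Rel (vertex K x * vertex K y) 0
  | source_mul_edge (e : E.Edge) : Rel (vertex K (E.s e) * edge K e) (edge K e)
  | edge_mul_range (e : E.Edge) : Rel (edge K e * vertex K (E.r e)) (edge K e)
  | range_mul_ghost (e : E.Edge) : Rel (vertex K (E.r e) * ghost K e) (ghost K e)
  | ghost_mul_source (e : E.Edge) : Rel (ghost K e * vertex K (E.s e)) (ghost K e)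
  | ghost_mul_edge_self (e : E.Edge) : Rel (ghost K e * edge K e) (vertex K (E.r e))
  | ghost_mul_edge_of_ne (e f : E.Edge) (h : e ≠ f) : Rel (ghost K e * edge K f) 0
  | cuntzKrieger (x : E.Vertex) (h : E.IsRegular x) :
      Rel (∑ e ∈ (E.rowFinite x).toFinset, edge K e * ghost K e) (vertex K x)

variable (E) in
/-- The congruence of `K`-algebras generated by the defining relations: the ring congruence
generated by all scalar multiples of them. -/
def con : RingCon (LeavittFree K E) :=
  ringConGen fun a b => ∃ (k : K) (x y : LeavittFree K E), Rel K x y ∧ a = k • x ∧ b = k • y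

theorem con_smul (k : K) (a b : LeavittFree K E) (h : con K E a b) :
    con K E (k • a) (k • b) := by
  change RingConGen.Rel _ a b at h
  change RingConGen.Rel _ (k • a) (k • b)
  induction h with
  | of x y h =>
    obtain ⟨l, x, y, h, rfl, rfl⟩ := h
    exact .of _ _ ⟨k * l, x, y, h, (mul_smul _ _ _).symm, (mul_smul _ _ _).symm⟩
  | refl x => exact .refl _
  | symm _ ih => exact .symm ih
  | trans _ _ ih₁ ih₂ => exact .trans ih₁ ih₂
  | add _ _ ih₁ ih₂ => simpa only [smul_add] using RingConGen.Rel.add ih₁ ih₂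
  | mul _ h₂ ih₁ _ => simpa only [smul_mul_assoc] using RingConGen.Rel.mul ih₁ h₂

end LeavittFree

/-- The Leavitt path algebra `L_K(E)`: the associative (not necessarily unital) `K`-algebra
generated by the vertices, edges and ghost edges subject to the defining relations. -/
def Leavitt (K : Type w) [Field K] (E : RowFiniteGraph.{u, v}) : Type (max u v w) :=
  (LeavittFree.con K E).Quotient

namespace Leavitt

variable (K : Type w) [Field K] {E : RowFiniteGraph.{u, v}}

instance : NonUnitalRing (Leavitt K E) :=
  inferInstanceAs (NonUnitalRing (LeavittFree.con K E).Quotient)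

instance : SMul K (Leavitt K E) := ⟨(LeavittFree.con K E).smulAux (LeavittFree.con_smul K)⟩

/-- The class in `L_K(E)` of an element of the free algebra. -/
def mk (a : LeavittFree K E) : Leavitt K E := (LeavittFree.con K E).toQuotient a

theorem mk_surjective : Function.Surjective (mk K (E := E)) := Quotient.mk''_surjective

theorem mk_add (a b : LeavittFree K E) : mk K (a + b) = mk K a + mk K b := rfl

theorem mk_smul (k : K) (a : LeavittFree K E) : mk K (k • a) = k • mk K a := rfl

theorem mk_mul (a b : LeavittFree K E) : mk K (a * b) = mk K a * mk K b := rfl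

instance : Module K (Leavitt K E) where
  one_smul := (mk_surjective K).forall.2 fun a => by rw [← mk_smul, one_smul]
  mul_smul k l := (mk_surjective K).forall.2 fun a => by simp only [← mk_smul, mul_smul]
  smul_zero k := by
    change k • mk K 0 = mk K 0
    rw [← mk_smul, smul_zero]
  smul_add k := (mk_surjective K).forall₂.2 fun a b => by
    simp only [← mk_smul, ← mk_add, smul_add]
  add_smul k l := (mk_surjective K).forall.2 fun a => by
    simp only [← mk_smul, ← mk_add, add_smul]
  zero_smul := (mk_surjective K).forall.2 fun a => by
    rw [← mk_smul, zero_smul]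
    rfl

instance : IsScalarTower K (Leavitt K E) (Leavitt K E) where
  smul_assoc k := (mk_surjective K).forall₂.2 fun a b => by
    simp only [smul_eq_mul, ← mk_smul, ← mk_mul, smul_mul_assoc]

instance : SMulCommClass K (Leavitt K E) (Leavitt K E) where
  smul_comm k := (mk_surjective K).forall₂.2 fun a b => by
    simp only [smul_eq_mul, ← mk_smul, ← mk_mul, mul_smul_comm]

/-- A generator as an element of `L_K(E)`. -/
def gen (g : LeavittGen E) : Leavitt K E := mk K (LeavittFree.gen K g)

/-- A vertex as an element of `L_K(E)`. -/
abbrev vertex (x : E.Vertex) : Leavitt K E := gen K (.vertex x)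

/-- An edge as an element of `L_K(E)`. -/
abbrev edge (e : E.Edge) : Leavitt K E := gen K (.edge e)

/-- A ghost edge as an element of `L_K(E)`. -/
abbrev ghost (e : E.Edge) : Leavitt K E := gen K (.ghost e)

theorem mk_eq_of_rel {a b : LeavittFree K E} (h : LeavittFree.Rel K a b) : mk K a = mk K b :=
  (RingCon.eq _).2 (RingConGen.Rel.of _ _ ⟨1, a, b, h, (one_smul _ _).symm, (one_smul _ _).symm⟩)

theorem mk_sum {ι : Type*} (t : Finset ι) (f : ι → LeavittFree K E) :
    mk K (∑ i ∈ t, f i) = ∑ i ∈ t, mk K (f i) :=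
  map_sum (AddMonoidHom.mk' (mk K (E := E)) (mk_add K)) f t

theorem vertex_mul_self (x : E.Vertex) : vertex K x * vertex K x = vertex K x :=
  mk_eq_of_rel K (.vertex_mul_self x)

theorem vertex_mul_of_ne {x y : E.Vertex} (h : x ≠ y) : vertex K x * vertex K y = 0 :=
  mk_eq_of_rel K (.vertex_mul_of_ne x y h)

theorem source_mul_edge (e : E.Edge) : vertex K (E.s e) * edge K e = edge K e :=
  mk_eq_of_rel K (.source_mul_edge e)

theorem edge_mul_range (e : E.Edge) : edge K e * vertex K (E.r e) = edge K e :=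
  mk_eq_of_rel K (.edge_mul_range e)

theorem range_mul_ghost (e : E.Edge) : vertex K (E.r e) * ghost K e = ghost K e :=
  mk_eq_of_rel K (.range_mul_ghost e)

theorem ghost_mul_source (e : E.Edge) : ghost K e * vertex K (E.s e) = ghost K e :=
  mk_eq_of_rel K (.ghost_mul_source e)

theorem ghost_mul_edge_self (e : E.Edge) : ghost K e * edge K e = vertex K (E.r e) :=
  mk_eq_of_rel K (.ghost_mul_edge_self e)

theorem ghost_mul_edge_of_ne {e f : E.Edge} (h : e ≠ f) : ghost K e * edge K f = 0 :=
  mk_eq_of_rel K (.ghost_mul_edge_of_ne e f h)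

theorem cuntzKrieger {x : E.Vertex} (h : E.IsRegular x) :
    ∑ e ∈ (E.rowFinite x).toFinset, edge K e * ghost K e = vertex K x := by
  rw [vertex, gen, ← mk_eq_of_rel K (.cuntzKrieger x h), mk_sum]
  rfl

section Lift

variable {K} {B : Type*} [NonUnitalRing B] [Module K B] [IsScalarTower K B B] [SMulCommClass K B B]

/-- The homomorphism from the free algebra determined by the images of the generators. -/
def freeLift (φ : LeavittGen E → B) : LeavittFree K E →ₙₐ[K] B :=
  MonoidAlgebra.liftMagma K (FreeSemigroup.lift φ)

@[simp]
theorem freeLift_gen (φ : LeavittGen E → B) (g : LeavittGen E) :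
    freeLift φ (LeavittFree.gen K g) = φ g := by
  simp [freeLift, LeavittFree.gen]

theorem freeLift_eq_of_con (φ : LeavittGen E → B)
    (h : ∀ a b : LeavittFree K E, LeavittFree.Rel K a b → freeLift φ a = freeLift φ b)
    (a b : LeavittFree K E) (hab : LeavittFree.con K E a b) : freeLift φ a = freeLift φ b := by
  change RingConGen.Rel _ a b at hab
  induction hab with
  | of x y hxy =>
    obtain ⟨l, x, y, hxy, rfl, rfl⟩ := hxy
    rw [map_smul, map_smul, h x y hxy]
  | refl x => rfl
  | symm _ ih => exact ih.symm
  | trans _ _ ih₁ ih₂ => exact ih₁.trans ih₂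
  | add _ _ ih₁ ih₂ => rw [map_add, map_add, ih₁, ih₂]
  | mul _ _ ih₁ ih₂ => rw [map_mul, map_mul, ih₁, ih₂]

/-- The universal property of `L_K(E)`: images of the generators that satisfy the defining
relations determine a homomorphism of `K`-algebras. -/
def lift (φ : LeavittGen E → B)
    (h : ∀ a b : LeavittFree K E, LeavittFree.Rel K a b → freeLift φ a = freeLift φ b) :
    Leavitt K E →ₙₐ[K] B where
  toFun := Quotient.lift (freeLift φ) (freeLift_eq_of_con φ h)
  map_smul' k := (mk_surjective K).forall.2 fun a => map_smul (freeLift φ) k a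
  map_zero' := map_zero (freeLift φ)
  map_add' := (mk_surjective K).forall₂.2 fun a b => map_add (freeLift φ) a b
  map_mul' := (mk_surjective K).forall₂.2 fun a b => map_mul (freeLift φ) a b

@[simp]
theorem lift_gen (φ : LeavittGen E → B)
    (h : ∀ a b : LeavittFree K E, LeavittFree.Rel K a b → freeLift φ a = freeLift φ b)
    (g : LeavittGen E) : lift φ h (gen K g) = φ g :=
  freeLift_gen φ g

end Lift

/-- The two-sided ideal `I(X)` of `L_K(E)` generated by a set `X` of vertices. -/
def idealOf (X : Set E.Vertex) : TwoSidedIdeal (Leavitt K E) :=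
  TwoSidedIdeal.span (vertex K '' X)

open Classical in
/-- The images in `L_K(E / X)` of the generators of `L_K(E)`: those that survive in the quotient
graph are sent to themselves, the others to zero. -/
def quotientGen (X : Set E.Vertex) : LeavittGen E → Leavitt K (E.quotient X)
  | .vertex x => if h : x ∉ X then vertex K (E := E.quotient X) ⟨x, h⟩ else 0
  | .edge e => if h : E.s e ∉ X ∧ E.r e ∉ X then edge K (E := E.quotient X) ⟨e, h⟩ else 0
  | .ghost e => if h : E.s e ∉ X ∧ E.r e ∉ X then ghost K (E := E.quotient X) ⟨e, h⟩ else 0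

theorem quotientGen_rel {X : Set E.Vertex} (hX : E.IsHereditary X) (hX' : E.IsSaturated X)
    (a b : LeavittFree K E) (hab : LeavittFree.Rel K a b) :
    freeLift (quotientGen K X) a = freeLift (quotientGen K X) b := by
  classical
  have hsr : ∀ {e : E.Edge}, E.r e ∉ X → E.s e ∉ X := fun h h' => h (hX.r_mem h')
  cases hab with
  | vertex_mul_self x =>
    by_cases h : x ∈ X <;> simp [quotientGen, h]
    exact vertex_mul_self K (E := E.quotient X) ⟨x, h⟩
  | vertex_mul_of_ne x y hxy =>
    by_cases h : x ∈ X <;> by_cases h' : y ∈ X <;> simp [quotientGen, h, h']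
    exact vertex_mul_of_ne K (fun h => hxy (congrArg Subtype.val h))
  | source_mul_edge e =>
    by_cases h : E.s e ∈ X <;> by_cases h' : E.r e ∈ X <;> simp [quotientGen, h, h']
    exact source_mul_edge K (E := E.quotient X) ⟨e, h, h'⟩
  | edge_mul_range e =>
    by_cases h : E.s e ∈ X <;> by_cases h' : E.r e ∈ X <;> simp [quotientGen, h, h']
    exact edge_mul_range K (E := E.quotient X) ⟨e, h, h'⟩
  | range_mul_ghost e =>
    by_cases h : E.s e ∈ X <;> by_cases h' : E.r e ∈ X <;> simp [quotientGen, h, h']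
    exact range_mul_ghost K (E := E.quotient X) ⟨e, h, h'⟩
  | ghost_mul_source e =>
    by_cases h : E.s e ∈ X <;> by_cases h' : E.r e ∈ X <;> simp [quotientGen, h, h']
    exact ghost_mul_source K (E := E.quotient X) ⟨e, h, h'⟩
  | ghost_mul_edge_self e =>
    by_cases h' : E.r e ∈ X
    · simp [quotientGen, h']
    · have h := hsr h'
      simp [quotientGen, h, h']
      exact ghost_mul_edge_self K (E := E.quotient X) ⟨e, h, h'⟩
  | ghost_mul_edge_of_ne e f hef =>
    by_cases h : E.s e ∉ X ∧ E.r e ∉ X <;> by_cases h' : E.s f ∉ X ∧ E.r f ∉ X <;>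
      simp [quotientGen, h, h']
    exact ghost_mul_edge_of_ne K (fun h => hef (congrArg Subtype.val h))
  | cuntzKrieger x hx =>
    simp only [map_sum, map_mul, freeLift_gen]
    by_cases h : x ∈ X
    · simp only [quotientGen, h, not_true_eq_false, dite_false]
      refine Finset.sum_eq_zero fun e he => ?_
      have he' : E.s e = x := by simpa using he
      simp [he', h]
    · have hreg : (E.quotient X).IsRegular ⟨x, h⟩ := by
        by_contra hcon
        refine h (hX' x hx fun e he => ?_)
        by_contra hr
        exact hcon ⟨⟨e, hsr hr, hr⟩, Subtype.ext he⟩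
      have key := cuntzKrieger K hreg
      simp only [quotientGen, h, not_false_eq_true, dite_true]
      rw [← key]
      symm
      refine Finset.sum_of_injOn Subtype.val Subtype.val_injective.injOn ?_ ?_ ?_
      · intro e he
        have : (E.quotient X).s e = ⟨x, h⟩ := 
          (Set.Finite.mem_toFinset ((E.quotient X).rowFinite ⟨x, h⟩)).1 he
        exact (Set.Finite.mem_toFinset _).2 (congrArg Subtype.val this)
      · intro e he hne
        have he' : E.s e = x := by simpa using he
        by_cases hr : E.r e ∈ X
        · simp [hr]
        · refine (hne ⟨⟨e, hsr hr, hr⟩, ?_, rfl⟩).elim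
          exact (Set.Finite.mem_toFinset _).2 (Subtype.ext he')
      · intro e _
        rw [dif_pos e.2, dif_pos e.2]
        rfl

/-- The homomorphism `L_K(E) → L_K(E / X)`, for a hereditary saturated set `X`, that is the
identity on the generators that survive in `E / X` and zero on the others. -/
def toQuotientGraph {X : Set E.Vertex} (hX : E.IsHereditary X) (hX' : E.IsSaturated X) :
    Leavitt K E →ₙₐ[K] Leavitt K (E.quotient X) :=
  lift (quotientGen K X) (quotientGen_rel K hX hX')

theorem toQuotientGraph_idealOf {X : Set E.Vertex} (hX : E.IsHereditary X)
    (hX' : E.IsSaturated X) :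
    idealOf K X ≤ TwoSidedIdeal.ker (toQuotientGraph K hX hX') := by
  refine TwoSidedIdeal.span_le.2 ?_
  rintro _ ⟨x, hx, rfl⟩
  rw [SetLike.mem_coe, TwoSidedIdeal.mem_ker]
  simp [toQuotientGraph, quotientGen, hx]

/-- The quotient ring `L_K(E) / I(X)`. -/
abbrev QuotientRing (X : Set E.Vertex) : Type (max u v w) := (idealOf K X).ringCon.Quotient

/-- The class `a + I(X)`. -/
def toQuotientRing (X : Set E.Vertex) (a : Leavitt K E) : QuotientRing K X :=
  (idealOf K X).ringCon.toQuotient a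

/-- The canonical map `θ : L_K(E) / I(X) → L_K(E / X)`, for a hereditary saturated set `X`:
`θ (g + I(X)) = g` for each vertex, edge or ghost edge `g` of `E / X`. -/
def theta {X : Set E.Vertex} (hX : E.IsHereditary X) (hX' : E.IsSaturated X) :
    QuotientRing K X →ₙ+* Leavitt K (E.quotient X) where
  toFun := Quotient.lift (toQuotientGraph K hX hX') fun _ _ h =>
    TwoSidedIdeal.ringCon_le_iff.1 (toQuotientGraph_idealOf K hX hX') h
  map_zero' := map_zero (toQuotientGraph K hX hX')
  map_add' := Quotient.mk''_surjective.forall₂.2 fun a b => map_add (toQuotientGraph K hX hX') a b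
  map_mul' := Quotient.mk''_surjective.forall₂.2 fun a b => map_mul (toQuotientGraph K hX hX') a b

theorem theta_toQuotientRing {X : Set E.Vertex} (hX : E.IsHereditary X) (hX' : E.IsSaturated X)
    (g : LeavittGen E) :
    theta K hX hX' (toQuotientRing K X (gen K g)) = quotientGen K X g :=
  lift_gen (quotientGen K X) (quotientGen_rel K hX hX') g

end Leavitt

/-! ### Point functors -/

/-- A point functor: a subfunctor of `E ↦ E⁰` on the category of graphs and isomorphisms. -/
abbrev PointFunctor := Subfunctor RowFiniteGraph.vertexFunctor.{u, v}

/-- The set `H(E)` as a set of vertices of `E`. -/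
def PointFunctor.vertices (H : PointFunctor.{u, v}) (E : RowFiniteGraph.{u, v}) :
    Set E.Vertex := H.obj E

/-- A hereditary saturated point functor: `H(E)` is hereditary and saturated for every `E`. -/
structure HSPointFunctor where
  toPointFunctor : PointFunctor.{u, v}
  hereditary : ∀ E : RowFiniteGraph.{u, v}, E.IsHereditary (toPointFunctor.vertices E)
  saturated : ∀ E : RowFiniteGraph.{u, v}, E.IsSaturated (toPointFunctor.vertices E)

/-- A point functor is invariant under isomorphism if `f(I(H(E))) = I(H(F))` for every ring
isomorphism `f : L_K(E) → L_K(F)`. -/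
def PointFunctor.IsInvariant (K : Type w) [Field K] (H : PointFunctor.{u, v}) : Prop :=
  ∀ (E F : RowFiniteGraph.{u, v}) (f : Leavitt K E ≃+* Leavitt K F),
    f '' (Leavitt.idealOf K (H.vertices E) : Set (Leavitt K E)) =
      (Leavitt.idealOf K (H.vertices F) : Set (Leavitt K F))

namespace HSPointFunctor

/-- `H(E)` -/
def vertices (H : HSPointFunctor.{u, v}) (E : RowFiniteGraph.{u, v}) : Set E.Vertex :=
  H.toPointFunctor.vertices E

/-- The canonical map `θ : L_K(E) / I(H(E)) → L_K(E / H(E))`. -/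
def theta (K : Type w) [Field K] (H : HSPointFunctor.{u, v}) (E : RowFiniteGraph.{u, v}) :
    Leavitt.QuotientRing K (H.vertices E) →ₙ+* Leavitt K (E.quotient (H.vertices E)) :=
  Leavitt.theta K (H.hereditary E) (H.saturated E)

/-- `S = (H⁽¹⁾, H⁽²⁾, …)` is the series of functors of `H`: `H⁽¹⁾ = H` and, for every `n ≥ 1` and
every graph `E`, one has `I(H⁽ⁿ⁾(E)) ⊆ I(H⁽ⁿ⁺¹⁾(E))` and the ideal
`I(H⁽ⁿ⁺¹⁾(E)) / I(H⁽ⁿ⁾(E))` of `L_K(E) / I(H⁽ⁿ⁾(E))` corresponds under `θ` to the ideal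
`I(H(E / H⁽ⁿ⁾(E)))` of `L_K(E / H⁽ⁿ⁾(E))`. -/
structure IsSeries (K : Type w) [Field K] (H : HSPointFunctor.{u, v})
    (S : ℕ+ → HSPointFunctor.{u, v}) : Prop where
  one : S 1 = H
  ideal_le : ∀ n E,
    Leavitt.idealOf K ((S n).vertices E) ≤ Leavitt.idealOf K ((S (n + 1)).vertices E)
  ideal_eq : ∀ n E,
    (S n).theta K E '' (Leavitt.toQuotientRing K ((S n).vertices E) ''
        (Leavitt.idealOf K ((S (n + 1)).vertices E) : Set (Leavitt K E))) =
      (Leavitt.idealOf K (H.vertices (E.quotient ((S n).vertices E))) :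
        Set (Leavitt K (E.quotient ((S n).vertices E))))

end HSPointFunctor

end

/-!
For a hereditary saturated set `X`, the homomorphism `L_K(E) → L_K(E / X)` is surjective with kernel
`I(X)` (`toQuotientGraph_eq_zero`): the generators of `L_K(E / X)` have representatives in
`L_K(E) / I(X)` that satisfy the defining relations, because edges ending in `X` lie in `I(X)` and
so drop out of the Cuntz-Krieger relation; this gives the inverse of `θ`.

Vertices are nonzero in `L_K(E)` (`vertex_ne_zero`). This is seen in a representation on the
functions `E⁰ × ℕ → K`, built from a partition of `{x} × ℕ`, for each regular vertex `x`, into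
copies of `{r(e)} × ℕ`, one for each edge `e` emitted by `x`. Applied to `E / X`, it shows that
`I(X)` contains no vertex outside `X`, so `X ↦ I(X)` is an order embedding on hereditary saturated
sets.

The image of `I(Y)` in `L_K(E / X)` is `I(Y \ X)`, hence the two conditions on the next term of the
series say exactly that `H⁽ⁿ⁺¹⁾(E) = H⁽ⁿ⁾(E) ∪ H(E / H⁽ⁿ⁾(E))` (`idealOf_le_and_image_eq_iff`). The
right-hand side is again hereditary, saturated and functorial, and existence and uniqueness follow
by recursion. For invariance, induct on `n`: an isomorphism `L_K(E) ≅ L_K(F)` that matches the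
ideals of the `n`-th terms descends to `L_K(E / H⁽ⁿ⁾(E)) ≅ L_K(F / H⁽ⁿ⁾(F))`, where the invariance
of `H` applies (`IsSeries.isInvariant`).
-/

/-! ### Hereditary and saturated sets, quotient graphs -/

namespace RowFiniteGraph

variable {E : RowFiniteGraph.{u, v}}

theorem isHereditary_of_r_mem {X : Set E.Vertex}
    (h : ∀ e : E.Edge, E.s e ∈ X → E.r e ∈ X) : E.IsHereditary X := by
  intro x hx y hxy
  induction hxy with
  | refl => exact hx
  | tail _ hbc ih =>
    obtain ⟨e, rfl, rfl⟩ := hbc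
    exact h e ih

theorem IsHereditary.preimage_quotient {X Y : Set E.Vertex} (hY : E.IsHereditary Y) :
    (E.quotient X).IsHereditary (Subtype.val ⁻¹' Y) :=
  isHereditary_of_r_mem fun _ he => hY.r_mem he

theorem IsSaturated.preimage_quotient {X Y : Set E.Vertex} (hX : E.IsHereditary X)
    (hXY : X ⊆ Y) (hY : E.IsSaturated Y) :
    (E.quotient X).IsSaturated (Subtype.val ⁻¹' Y) := by
  rintro x ⟨e₀, he₀⟩ hx
  refine hY x.1 ⟨e₀.1, congrArg Subtype.val he₀⟩ fun e he => ?_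
  by_cases hr : E.r e ∈ X
  · exact hXY hr
  · exact hx ⟨e, fun hs => hr (hX.r_mem hs), hr⟩ (Subtype.ext he)

theorem IsHereditary.union_image_quotient {X : Set E.Vertex} (hX : E.IsHereditary X)
    {Z : Set (E.quotient X).Vertex} (hZ : (E.quotient X).IsHereditary Z) :
    E.IsHereditary (X ∪ Subtype.val '' Z) := by
  refine isHereditary_of_r_mem fun e he => ?_
  by_cases hr : E.r e ∈ X
  · exact .inl hr
  obtain hs | ⟨z, hz, hzs⟩ := he
  · exact .inl (hX.r_mem hs)
  · have hs : E.s e ∉ X := fun hs => hr (hX.r_mem hs)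
    refine .inr ⟨⟨E.r e, hr⟩, hZ.r_mem (e := ⟨e, hs, hr⟩) ?_, rfl⟩
    obtain rfl : z = ⟨E.s e, hs⟩ := Subtype.ext hzs
    exact hz

theorem IsSaturated.union_image_quotient {X : Set E.Vertex} (hX : E.IsHereditary X)
    (hX' : E.IsSaturated X) {Z : Set (E.quotient X).Vertex}
    (hZ : (E.quotient X).IsSaturated Z) :
    E.IsSaturated (X ∪ Subtype.val '' Z) := by
  intro x hx h
  by_cases hxX : x ∈ X
  · exact .inl hxX
  refine .inr ⟨⟨x, hxX⟩, hZ _ ?_ ?_, rfl⟩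
  · -- `X` is saturated, so `x ∉ X` emits an edge that survives in the quotient graph.
    by_contra hcon
    refine hxX (hX' x hx fun e he => ?_)
    by_contra hr
    exact hcon ⟨⟨e, fun hs => hr (hX.r_mem hs), hr⟩, Subtype.ext he⟩
  · rintro ⟨e, hs, hr⟩ he
    obtain hr' | ⟨z, hz, hzr⟩ := h e (congrArg Subtype.val he)
    · exact (hr hr').elim
    · obtain rfl : z = ⟨E.r e, hr⟩ := Subtype.ext hzr
      exact hz

/-! ### Isomorphisms of graphs -/

/-- The inverse of an isomorphism of graphs. -/
def GraphIso.symm {E F : RowFiniteGraph.{u, v}} (α : GraphIso E F) : GraphIso F E where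
  vertexEquiv := α.vertexEquiv.symm
  edgeEquiv := α.edgeEquiv.symm
  map_s e := by rw [Equiv.eq_symm_apply, ← α.map_s, Equiv.apply_symm_apply]
  map_r e := by rw [Equiv.eq_symm_apply, ← α.map_r, Equiv.apply_symm_apply]

/-- The isomorphism `E / X → F / Y` induced by an isomorphism of graphs that matches `X` with
`Y`. -/
def GraphIso.quotient {E F : RowFiniteGraph.{u, v}} (α : GraphIso E F) {X : Set E.Vertex}
    {Y : Set F.Vertex} (h : ∀ x, x ∈ X ↔ α.vertexEquiv x ∈ Y) :
    GraphIso (E.quotient X) (F.quotient Y) where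
  vertexEquiv := α.vertexEquiv.subtypeEquiv fun x => not_congr (h x)
  edgeEquiv := α.edgeEquiv.subtypeEquiv fun e => by rw [h, h, α.map_s, α.map_r]
  map_s e := Subtype.ext (α.map_s e.1)
  map_r e := Subtype.ext (α.map_r e.1)

/-! ### Self-similar labellings -/

/-- A self-similar labelling of a graph by natural numbers: `σ e n` is the label at the source of
`e` that the edge `e` assigns to the label `n` at its range. For every regular vertex `x`, the
labels `ℕ` at `x` are the disjoint union of the images of the injections `σ e` for the edges `e`
emitted by `x`; this is possible since `s⁻¹(x)` is finite and nonempty. -/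
theorem exists_branching (E : RowFiniteGraph.{u, v}) :
    ∃ σ : E.Edge → ℕ → ℕ,
      (∀ e f m n, E.s e = E.s f → σ e m = σ f n → e = f ∧ m = n) ∧
      ∀ x, E.IsRegular x → ∀ m, ∃ e n, E.s e = x ∧ σ e n = m := by
  have hφ : ∀ x, E.IsRegular x → Nonempty ({e // E.s e = x} × ℕ ≃ ℕ) := by
    rintro x ⟨e, he⟩
    have : Finite {e // E.s e = x} := (E.rowFinite x).to_subtype
    have : Nonempty {e // E.s e = x} := ⟨⟨e, he⟩⟩
    exact nonempty_equiv_of_countable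
  let φ x hx := (hφ x hx).some
  have φs (e : E.Edge) (n : ℕ) {x} (hx : E.s e = x) :
      φ (E.s e) ⟨e, rfl⟩ (⟨e, rfl⟩, n) = φ x ⟨e, hx⟩ (⟨e, hx⟩, n) := by
    subst hx; rfl
  refine ⟨fun e n => φ (E.s e) ⟨e, rfl⟩ (⟨e, rfl⟩, n), ?_, ?_⟩
  · intro e f m n hef h
    dsimp only at h
    rw [φs e m hef] at h
    have := (φ _ ⟨f, rfl⟩).injective h
    simpa using this
  · intro x hx m
    obtain ⟨⟨⟨e, he⟩, n⟩, h⟩ := (φ x hx).surjective m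
    exact ⟨e, n, he, (φs e n he).trans h⟩

end RowFiniteGraph

namespace Leavitt

variable {K : Type w} [Field K] {E : RowFiniteGraph.{u, v}}

/-! ### Vertices are nonzero in the Leavitt path algebra -/

/-- Induction on the construction of elements of `L_K(E)` from the generators. -/
theorem induction {p : Leavitt K E → Prop} (gen : ∀ g, p (gen K g)) (zero : p 0)
    (add : ∀ a b, p a → p b → p (a + b)) (mul : ∀ a b, p a → p b → p (a * b))
    (smul : ∀ (k : K) a, p a → p (k • a)) (a : Leavitt K E) : p a := by
  have word (s : FreeSemigroup (LeavittGen E)) : p (mk K (MonoidAlgebra.single s 1)) := by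
    induction s using FreeSemigroup.recOnMul with
    | ih1 g => exact gen g
    | ih2 g s ih₁ ih₂ =>
      rw [← one_mul (1 : K), ← MonoidAlgebra.single_mul_single, mk_mul]
      exact mul _ _ ih₁ ih₂
  obtain ⟨a, rfl⟩ := mk_surjective K a
  induction a using MonoidAlgebra.induction_linear with
  | zero => exact zero
  | add a b ha hb => exact mk_add K a b ▸ add _ _ ha hb
  | single s k =>
    rw [← mul_one k, ← smul_eq_mul, ← MonoidAlgebra.smul_single, mk_smul]
    exact smul _ _ (word s)

section Representation

variable (K) (σ : E.Edge → ℕ → ℕ)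

open Classical in
/-- The operators on the functions `E⁰ × ℕ → K` by which the generators act: a vertex `x`
restricts to `{x} × ℕ`, and the ghost edge of `e` pulls back along the injection
`(r(e), n) ↦ (s(e), σ e n)`, while `e` extends by zero along it. -/
noncomputable def genOp : LeavittGen E → Module.End K (E.Vertex → ℕ → K)
  | .vertex x =>
    { toFun f y n := if y = x then f y n else 0
      map_add' f g := by ext; dsimp; split_ifs <;> simp
      map_smul' k f := by ext; simp }
  | .edge e =>
    { toFun f y n := if y = E.s e then (Function.partialInv (σ e) n).elim 0 (f (E.r e)) else 0
      map_add' f g := by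
        ext y n; dsimp; split_ifs <;> cases Function.partialInv (σ e) n <;> simp
      map_smul' k f := by
        ext y n; dsimp; split_ifs <;> cases Function.partialInv (σ e) n <;> simp }
  | .ghost e =>
    { toFun f y n := if y = E.r e then f (E.s e) (σ e n) else 0
      map_add' f g := by ext; dsimp; split_ifs <;> simp
      map_smul' k f := by ext; simp }

theorem genOp_rel (hσ : ∀ e f m n, E.s e = E.s f → σ e m = σ f n → e = f ∧ m = n)
    (hσ' : ∀ x, E.IsRegular x → ∀ m, ∃ e n, E.s e = x ∧ σ e n = m)
    (a b : LeavittFree K E) (hab : LeavittFree.Rel K a b) :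
    freeLift (genOp K σ) a = freeLift (genOp K σ) b := by
  classical
  have hinv (e : E.Edge) (m n : ℕ) : Function.partialInv (σ e) n = some m ↔ σ e m = n :=
    Function.Injective.isPartialInv (fun m n h => (hσ e e m n rfl h).2) m n
  have hinv' (e : E.Edge) (n : ℕ) : Function.partialInv (σ e) (σ e n) = some n := by
    rw [hinv]
  have hne {e f : E.Edge} (hs : E.s f = E.s e) (h : e ≠ f) (n : ℕ) :
      Function.partialInv (σ f) (σ e n) = none := by
    rw [Option.eq_none_iff_forall_not_mem]
    intro m hm
    exact h (hσ f e m n hs ((hinv f m _).1 hm)).1.symm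
  cases hab with
  | vertex_mul_self x => ext f y n; simp +contextual [genOp]
  | vertex_mul_of_ne x z h =>
    ext f y n
    simp only [map_mul, freeLift_gen, map_zero, genOp, Module.End.mul_apply, LinearMap.coe_mk,
      AddHom.coe_mk, LinearMap.zero_apply, Pi.zero_apply]
    split_ifs with h₁ h₂
    · exact (h (h₁.symm.trans h₂)).elim
    all_goals rfl
  | source_mul_edge e => ext f y n; simp +contextual [genOp]
  | edge_mul_range e => ext f y n; simp [genOp]
  | range_mul_ghost e => ext f y n; simp +contextual [genOp]
  | ghost_mul_source e => ext f y n; simp [genOp]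
  | ghost_mul_edge_self e =>
    ext f y n
    by_cases h : y = E.r e
    · subst h; simp [genOp, hinv']
    · simp [genOp, h]
  | ghost_mul_edge_of_ne e f h =>
    ext g y n
    by_cases hs : E.s f = E.s e
    · simp [genOp, hne hs h]
    · simp [genOp, Ne.symm hs]
  | cuntzKrieger x hx =>
    ext f y m
    simp only [map_sum, map_mul, freeLift_gen, LinearMap.sum_apply, Finset.sum_apply]
    by_cases hy : y = x
    · subst hy
      obtain ⟨e, n, he, rfl⟩ := hσ' y hx m
      rw [Finset.sum_eq_single e]
      · subst he; simp [genOp, hinv']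
      · intro e' he' hee'
        have hs : E.s e' = E.s e := by rw [he]; simpa using he'
        simp [genOp, hne hs hee'.symm]
      · simp [he]
    · refine (Finset.sum_eq_zero fun e he => ?_).trans (by simp [genOp, hy])
      have hs : E.s e = x := by simpa using he
      simp [genOp, hs, hy]

end Representation

theorem vertex_ne_zero (x : E.Vertex) : vertex K x ≠ 0 := by
  obtain ⟨σ, hσ, hσ'⟩ := E.exists_branching
  intro h
  have := congrArg (lift (genOp K σ) (genOp_rel K σ hσ hσ')) h
  rw [lift_gen, map_zero] at this
  have := congrFun (congrFun (LinearMap.congr_fun this 1) x) 0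
  simp [genOp] at this

/-! ### Hereditary saturated sets are determined by their ideals -/

theorem vertex_mem_idealOf {X : Set E.Vertex} (hX : E.IsHereditary X) (hX' : E.IsSaturated X)
    {x : E.Vertex} : vertex K x ∈ idealOf K X ↔ x ∈ X := by
  refine ⟨fun h => ?_, fun h => TwoSidedIdeal.subset_span ⟨x, h, rfl⟩⟩
  by_contra hx
  have := (TwoSidedIdeal.mem_ker _).1 (toQuotientGraph_idealOf K hX hX' h)
  rw [toQuotientGraph, lift_gen] at this
  simp only [quotientGen, hx, not_false_eq_true, dite_true] at this
  exact vertex_ne_zero _ this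

theorem idealOf_le_idealOf_iff {X Y : Set E.Vertex} (hY : E.IsHereditary Y)
    (hY' : E.IsSaturated Y) : idealOf K X ≤ idealOf K Y ↔ X ⊆ Y :=
  ⟨fun h _ hx => (vertex_mem_idealOf hY hY').1 (h (TwoSidedIdeal.subset_span ⟨_, hx, rfl⟩)),
    fun h => TwoSidedIdeal.span_mono (Set.image_mono h)⟩

theorem eq_of_idealOf_eq {X Y : Set E.Vertex} (hX : E.IsHereditary X) (hX' : E.IsSaturated X)
    (hY : E.IsHereditary Y) (hY' : E.IsSaturated Y) (h : idealOf K X = idealOf K Y) : X = Y :=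
  ((idealOf_le_idealOf_iff hY hY').1 h.le).antisymm ((idealOf_le_idealOf_iff hX hX').1 h.ge)

/-! ### The `K`-algebra structure of `L_K(E) / I(X)` -/

section QuotientModule

variable (X : Set E.Vertex)

theorem smul_mem_idealOf (k : K) {a : Leavitt K E} (ha : a ∈ idealOf K X) :
    k • a ∈ idealOf K X := by
  induction ha using TwoSidedIdeal.span_induction with
  | mem a ha =>
    obtain ⟨x, hx, rfl⟩ := ha
    rw [← vertex_mul_self, ← smul_mul_assoc]
    exact TwoSidedIdeal.mul_mem_left _ _ _ (TwoSidedIdeal.subset_span ⟨x, hx, rfl⟩)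
  | zero => rw [smul_zero]; exact TwoSidedIdeal.zero_mem _
  | add a b _ _ ha hb => exact (smul_add k a b) ▸ TwoSidedIdeal.add_mem _ ha hb
  | neg a _ ha => exact (smul_neg k a) ▸ TwoSidedIdeal.neg_mem _ ha
  | left_absorb b a _ ha => exact (mul_smul_comm k b a) ▸ TwoSidedIdeal.mul_mem_left _ _ _ ha
  | right_absorb b a _ ha => exact (smul_mul_assoc k a b) ▸ TwoSidedIdeal.mul_mem_right _ _ _ ha

theorem toQuotientRing_surjective :
    Function.Surjective (toQuotientRing K X) := Quotient.mk''_surjective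

theorem toQuotientRing_eq_zero {X : Set E.Vertex} {a : Leavitt K E} :
    toQuotientRing K X a = 0 ↔ a ∈ idealOf K X :=
  RingCon.eq _

theorem toQuotientRing_add (a b : Leavitt K E) :
    toQuotientRing K X (a + b) = toQuotientRing K X a + toQuotientRing K X b := rfl

theorem toQuotientRing_mul (a b : Leavitt K E) :
    toQuotientRing K X (a * b) = toQuotientRing K X a * toQuotientRing K X b := rfl

theorem toQuotientRing_zero : toQuotientRing K X 0 = 0 := rfl

theorem toQuotientRing_sum {ι : Type*} (t : Finset ι) (f : ι → Leavitt K E) :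
    toQuotientRing K X (∑ i ∈ t, f i) = ∑ i ∈ t, toQuotientRing K X (f i) :=
  map_sum (AddMonoidHom.mk' (toQuotientRing K X) (toQuotientRing_add X)) f t

noncomputable instance : SMul K (QuotientRing K X) :=
  ⟨(idealOf K X).ringCon.smulAux fun k a b h => by
    rw [TwoSidedIdeal.rel_iff] at h ⊢
    rw [← smul_sub]
    exact smul_mem_idealOf X k h⟩

theorem toQuotientRing_smul (k : K) (a : Leavitt K E) :
    toQuotientRing K X (k • a) = k • toQuotientRing K X a := rfl

/-- `L_K(E) / I(X)` is a `K`-algebra: `I(X)` is stable under scalars, as it is generated by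
idempotents. -/
noncomputable instance : Module K (QuotientRing K X) where
  one_smul := (toQuotientRing_surjective X).forall.2 fun a => by
    rw [← toQuotientRing_smul, one_smul]
  mul_smul k l := (toQuotientRing_surjective X).forall.2 fun a => by
    simp only [← toQuotientRing_smul, mul_smul]
  smul_zero k := by
    rw [← toQuotientRing_zero, ← toQuotientRing_smul, smul_zero]
  smul_add k := (toQuotientRing_surjective X).forall₂.2 fun a b => by
    simp only [← toQuotientRing_smul, ← toQuotientRing_add, smul_add]
  add_smul k l := (toQuotientRing_surjective X).forall.2 fun a => by
    simp only [← toQuotientRing_smul, ← toQuotientRing_add, add_smul]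
  zero_smul := (toQuotientRing_surjective X).forall.2 fun a => by
    rw [← toQuotientRing_smul, zero_smul, toQuotientRing_zero]

instance : IsScalarTower K (QuotientRing K X) (QuotientRing K X) where
  smul_assoc k := (toQuotientRing_surjective X).forall₂.2 fun a b => by
    simp only [smul_eq_mul, ← toQuotientRing_smul, ← toQuotientRing_mul, smul_mul_assoc]

instance : SMulCommClass K (QuotientRing K X) (QuotientRing K X) where
  smul_comm k := (toQuotientRing_surjective X).forall₂.2 fun a b => by
    simp only [smul_eq_mul, ← toQuotientRing_smul, ← toQuotientRing_mul, mul_smul_comm]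

end QuotientModule

/-! ### Bijectivity of `θ` -/

section QuotientGraph

variable {X : Set E.Vertex}

theorem toQuotientRing_edge (hX : E.IsHereditary X) {e : E.Edge}
    (h : ¬(E.s e ∉ X ∧ E.r e ∉ X)) : toQuotientRing K X (edge K e) = 0 := by
  have hr : E.r e ∈ X := by
    by_contra hr
    exact h ⟨fun hs => hr (hX.r_mem hs), hr⟩
  rw [toQuotientRing_eq_zero, ← edge_mul_range]
  exact TwoSidedIdeal.mul_mem_left _ _ _ (TwoSidedIdeal.subset_span ⟨_, hr, rfl⟩)

theorem toQuotientRing_ghost (hX : E.IsHereditary X) {e : E.Edge}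
    (h : ¬(E.s e ∉ X ∧ E.r e ∉ X)) : toQuotientRing K X (ghost K e) = 0 := by
  have hr : E.r e ∈ X := by
    by_contra hr
    exact h ⟨fun hs => hr (hX.r_mem hs), hr⟩
  rw [toQuotientRing_eq_zero, ← range_mul_ghost]
  exact TwoSidedIdeal.mul_mem_right _ _ _ (TwoSidedIdeal.subset_span ⟨_, hr, rfl⟩)

variable (K X) in
/-- The classes in `L_K(E) / I(X)` of the generators of `L_K(E / X)`. -/
noncomputable def thetaInvGen : LeavittGen (E.quotient X) → QuotientRing K X
  | .vertex x => toQuotientRing K X (vertex K x.1)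
  | .edge e => toQuotientRing K X (edge K e.1)
  | .ghost e => toQuotientRing K X (ghost K e.1)

theorem thetaInvGen_rel (hX : E.IsHereditary X) (a b : LeavittFree K (E.quotient X))
    (hab : LeavittFree.Rel K a b) :
    freeLift (thetaInvGen K X) a = freeLift (thetaInvGen K X) b := by
  cases hab with
  | vertex_mul_self x =>
    simp only [map_mul, freeLift_gen, thetaInvGen, ← toQuotientRing_mul, Leavitt.vertex_mul_self]
  | vertex_mul_of_ne x y h =>
    simp only [map_mul, freeLift_gen, thetaInvGen, ← toQuotientRing_mul, map_zero]
    rw [Leavitt.vertex_mul_of_ne K fun h' => h (Subtype.ext h'), toQuotientRing_zero]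
  | source_mul_edge e =>
    simp only [map_mul, freeLift_gen, thetaInvGen, ← toQuotientRing_mul]
    exact congrArg _ (Leavitt.source_mul_edge K e.1)
  | edge_mul_range e =>
    simp only [map_mul, freeLift_gen, thetaInvGen, ← toQuotientRing_mul]
    exact congrArg _ (Leavitt.edge_mul_range K e.1)
  | range_mul_ghost e =>
    simp only [map_mul, freeLift_gen, thetaInvGen, ← toQuotientRing_mul]
    exact congrArg _ (Leavitt.range_mul_ghost K e.1)
  | ghost_mul_source e =>
    simp only [map_mul, freeLift_gen, thetaInvGen, ← toQuotientRing_mul]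
    exact congrArg _ (Leavitt.ghost_mul_source K e.1)
  | ghost_mul_edge_self e =>
    simp only [map_mul, freeLift_gen, thetaInvGen, ← toQuotientRing_mul]
    exact congrArg _ (Leavitt.ghost_mul_edge_self K e.1)
  | ghost_mul_edge_of_ne e f h =>
    simp only [map_mul, freeLift_gen, thetaInvGen, ← toQuotientRing_mul, map_zero]
    rw [Leavitt.ghost_mul_edge_of_ne K fun h' => h (Subtype.ext h'), toQuotientRing_zero]
  | cuntzKrieger x hx =>
    obtain ⟨e₀, he₀⟩ := hx
    simp only [map_sum, map_mul, freeLift_gen, thetaInvGen]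
    rw [← Leavitt.cuntzKrieger K (x := x.1) ⟨e₀.1, congrArg Subtype.val he₀⟩,
      toQuotientRing_sum]
    refine Finset.sum_of_injOn Subtype.val Subtype.val_injective.injOn ?_ ?_ fun _ _ => rfl
    · intro e he
      have : (E.quotient X).s e = x :=
        (Set.Finite.mem_toFinset ((E.quotient X).rowFinite x)).1 he
      exact (Set.Finite.mem_toFinset _).2 (congrArg Subtype.val this)
    · intro e he hne
      have he' : E.s e = x.1 := by simpa using he
      -- Edges that do not survive in `E / X` contribute nothing modulo `I(X)`.
      rw [toQuotientRing_mul, toQuotientRing_edge hX, zero_mul]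
      intro h
      refine hne ⟨⟨e, h⟩, ?_, rfl⟩
      exact (Set.Finite.mem_toFinset _).2 (Subtype.ext he')

theorem lift_thetaInvGen_toQuotientGraph (hX : E.IsHereditary X) (hX' : E.IsSaturated X)
    (a : Leavitt K E) :
    lift (thetaInvGen K X) (thetaInvGen_rel hX) (toQuotientGraph K hX hX' a) =
      toQuotientRing K X a := by
  induction a using Leavitt.induction with
  | gen g =>
    rw [toQuotientGraph, lift_gen]
    cases g with
    | vertex x =>
      by_cases h : x ∈ X
      · simp only [quotientGen, h, not_true_eq_false, dite_false, map_zero]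
        exact (toQuotientRing_eq_zero.2 (TwoSidedIdeal.subset_span ⟨_, h, rfl⟩)).symm
      · simp only [quotientGen, h, not_false_eq_true, dite_true, lift_gen]
        rfl
    | edge e =>
      by_cases h : E.s e ∉ X ∧ E.r e ∉ X
      · rw [quotientGen, dif_pos h, lift_gen]
        rfl
      · rw [quotientGen, dif_neg h, map_zero]
        exact (toQuotientRing_edge hX h).symm
    | ghost e =>
      by_cases h : E.s e ∉ X ∧ E.r e ∉ X
      · rw [quotientGen, dif_pos h, lift_gen]
        rfl
      · rw [quotientGen, dif_neg h, map_zero]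
        exact (toQuotientRing_ghost hX h).symm
  | zero => simp only [map_zero, toQuotientRing_zero]
  | add a b ha hb => rw [map_add, map_add, ha, hb, toQuotientRing_add]
  | mul a b ha hb => rw [map_mul, map_mul, ha, hb, toQuotientRing_mul]
  | smul k a ha => rw [map_smul, map_smul, ha, toQuotientRing_smul]

theorem toQuotientGraph_eq_zero (hX : E.IsHereditary X) (hX' : E.IsSaturated X)
    {a : Leavitt K E} : toQuotientGraph K hX hX' a = 0 ↔ a ∈ idealOf K X := by
  refine ⟨fun h => ?_, fun h => (TwoSidedIdeal.mem_ker _).1 (toQuotientGraph_idealOf K hX hX' h)⟩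
  rw [← toQuotientRing_eq_zero, ← lift_thetaInvGen_toQuotientGraph hX hX', h, map_zero]

theorem toQuotientGraph_surjective (hX : E.IsHereditary X) (hX' : E.IsSaturated X) :
    Function.Surjective (toQuotientGraph K hX hX') := by
  intro b
  induction b using Leavitt.induction with
  | gen g =>
    cases g with
    | vertex x =>
      refine ⟨vertex K x.1, ?_⟩
      rw [toQuotientGraph, lift_gen, quotientGen, dif_pos x.2]
      rfl
    | edge e =>
      refine ⟨edge K e.1, ?_⟩
      rw [toQuotientGraph, lift_gen, quotientGen, dif_pos e.2]
      rfl
    | ghost e =>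
      refine ⟨ghost K e.1, ?_⟩
      rw [toQuotientGraph, lift_gen, quotientGen, dif_pos e.2]
      rfl
  | zero => exact ⟨0, map_zero _⟩
  | add a b ha hb =>
    obtain ⟨a, rfl⟩ := ha
    obtain ⟨b, rfl⟩ := hb
    exact ⟨a + b, map_add _ _ _⟩
  | mul a b ha hb =>
    obtain ⟨a, rfl⟩ := ha
    obtain ⟨b, rfl⟩ := hb
    exact ⟨a * b, map_mul _ _ _⟩
  | smul k a ha =>
    obtain ⟨a, rfl⟩ := ha
    exact ⟨k • a, map_smul _ _ _⟩

theorem theta_bijective (hX : E.IsHereditary X) (hX' : E.IsSaturated X) :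
    Function.Bijective (theta K hX hX') := by
  constructor
  · rw [injective_iff_map_eq_zero]
    refine (toQuotientRing_surjective X).forall.2 fun a ha => ?_
    exact toQuotientRing_eq_zero.2 ((toQuotientGraph_eq_zero hX hX').1 ha)
  · intro b
    obtain ⟨a, rfl⟩ := toQuotientGraph_surjective hX hX' b
    exact ⟨toQuotientRing K X a, rfl⟩

/-! ### Images of ideals in `L_K(E / X)` -/

theorem theta_image_toQuotientRing_image (hX : E.IsHereditary X) (hX' : E.IsSaturated X)
    (A : Set (Leavitt K E)) :
    theta K hX hX' '' (toQuotientRing K X '' A) = toQuotientGraph K hX hX' '' A :=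
  Set.image_image _ _ _

theorem toQuotientGraph_image_idealOf (hX : E.IsHereditary X) (hX' : E.IsSaturated X)
    (Y : Set E.Vertex) :
    toQuotientGraph K hX hX' '' (idealOf K Y : Set (Leavitt K E)) =
      (idealOf K (E := E.quotient X) (Subtype.val ⁻¹' Y) : Set (Leavitt K (E.quotient X))) := by
  set p := toQuotientGraph K hX hX' with hp
  have hpv (x : E.Vertex) : p (vertex K x) = quotientGen K X (.vertex x) := lift_gen _ _ _
  apply Set.Subset.antisymm
  · rintro _ ⟨a, ha, rfl⟩
    rw [SetLike.mem_coe] at ha ⊢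
    induction ha using TwoSidedIdeal.span_induction with
    | mem a ha =>
      obtain ⟨y, hy, rfl⟩ := ha
      rw [hpv]
      by_cases h : y ∈ X
      · simp only [quotientGen, h, not_true_eq_false, dite_false]
        exact TwoSidedIdeal.zero_mem _
      · simp only [quotientGen, h, not_false_eq_true, dite_true]
        exact TwoSidedIdeal.subset_span ⟨⟨y, h⟩, hy, rfl⟩
    | zero => exact (map_zero p).symm ▸ TwoSidedIdeal.zero_mem _
    | add a b _ _ ha hb => exact (map_add p a b).symm ▸ TwoSidedIdeal.add_mem _ ha hb
    | neg a _ ha => exact (map_neg p a).symm ▸ TwoSidedIdeal.neg_mem _ ha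
    | left_absorb b a _ ha =>
      exact (map_mul p b a).symm ▸ TwoSidedIdeal.mul_mem_left _ _ _ ha
    | right_absorb b a _ ha =>
      exact (map_mul p a b).symm ▸ TwoSidedIdeal.mul_mem_right _ _ _ ha
  · intro b hb
    rw [SetLike.mem_coe] at hb
    induction hb using TwoSidedIdeal.span_induction with
    | mem b hb =>
      obtain ⟨y, hy, rfl⟩ := hb
      refine ⟨vertex K y.1, TwoSidedIdeal.subset_span ⟨y.1, hy, rfl⟩, ?_⟩
      rw [hpv, quotientGen, dif_pos y.2]
      rfl
    | zero => exact ⟨0, TwoSidedIdeal.zero_mem _, map_zero p⟩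
    | add _ _ _ _ ha hb =>
      obtain ⟨a, ha, rfl⟩ := ha
      obtain ⟨b, hb, rfl⟩ := hb
      exact ⟨a + b, TwoSidedIdeal.add_mem _ ha hb, map_add p a b⟩
    | neg _ _ ha =>
      obtain ⟨a, ha, rfl⟩ := ha
      exact ⟨-a, TwoSidedIdeal.neg_mem _ ha, map_neg p a⟩
    | left_absorb c _ _ ha =>
      obtain ⟨a, ha, rfl⟩ := ha
      obtain ⟨c, rfl⟩ := toQuotientGraph_surjective hX hX' c
      exact ⟨c * a, TwoSidedIdeal.mul_mem_left _ _ _ ha, map_mul p c a⟩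
    | right_absorb c _ _ ha =>
      obtain ⟨a, ha, rfl⟩ := ha
      obtain ⟨c, rfl⟩ := toQuotientGraph_surjective hX hX' c
      exact ⟨a * c, TwoSidedIdeal.mul_mem_right _ _ _ ha, map_mul p a c⟩

/-- A hereditary saturated set `Y` satisfies the defining condition of the next term of the series,
relative to `X` and a hereditary saturated set `Z` of vertices of `E / X`, exactly when
`Y = X ∪ Z`: both `Y \ X` and `Z` are hereditary and saturated in `E / X`, so they agree once
their ideals do. -/
theorem idealOf_le_and_image_eq_iff (hX : E.IsHereditary X) (hX' : E.IsSaturated X)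
    {Y : Set E.Vertex} (hY : E.IsHereditary Y) (hY' : E.IsSaturated Y)
    {Z : Set (E.quotient X).Vertex} (hZ : (E.quotient X).IsHereditary Z)
    (hZ' : (E.quotient X).IsSaturated Z) :
    (idealOf K X ≤ idealOf K Y ∧
      theta K hX hX' '' (toQuotientRing K X '' (idealOf K Y : Set (Leavitt K E))) =
        (idealOf K Z : Set (Leavitt K (E.quotient X)))) ↔
      Y = X ∪ Subtype.val '' Z := by
  rw [theta_image_toQuotientRing_image, toQuotientGraph_image_idealOf,
    idealOf_le_idealOf_iff hY hY', SetLike.coe_set_eq]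
  constructor
  · rintro ⟨hXY, h⟩
    rw [← eq_of_idealOf_eq hY.preimage_quotient (hY'.preimage_quotient hX hXY) hZ hZ' h]
    ext y
    constructor
    · intro hy
      by_cases h : y ∈ X
      · exact .inl h
      · exact .inr ⟨⟨y, h⟩, hy, rfl⟩
    · rintro (h | ⟨y, hy, rfl⟩)
      · exact hXY h
      · exact hy
  · rintro rfl
    refine ⟨Set.subset_union_left, congrArg _ ?_⟩
    ext z
    refine ⟨?_, fun hz => .inr ⟨z, hz, rfl⟩⟩
    rintro (h | ⟨z', hz', h⟩)
    · exact (z.2 h).elim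
    · exact Subtype.ext h ▸ hz'

/-- If `I(Y)` contains `I(X)`, then it is the preimage of its image in `L_K(E / X)`. -/
theorem mem_idealOf_iff_toQuotientGraph_mem_image (hX : E.IsHereditary X)
    (hX' : E.IsSaturated X) {Y : Set E.Vertex} (h : idealOf K X ≤ idealOf K Y)
    {a : Leavitt K E} :
    a ∈ idealOf K Y ↔
      toQuotientGraph K hX hX' a ∈
        toQuotientGraph K hX hX' '' (idealOf K Y : Set (Leavitt K E)) := by
  refine ⟨fun ha => ⟨a, ha, rfl⟩, fun ⟨b, hb, hab⟩ => ?_⟩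
  have : a - b ∈ idealOf K X := by
    rw [← toQuotientGraph_eq_zero hX hX', map_sub, hab, sub_self]
  exact sub_add_cancel a b ▸ TwoSidedIdeal.add_mem _ (h this) hb

end QuotientGraph

/-! ### Descending isomorphisms to quotients -/

/-- A ring isomorphism that matches the kernels of two surjections descends to an isomorphism of
their targets. -/
theorem exists_ringEquiv_of_surjective {A B C D : Type*} [NonUnitalRing A] [NonUnitalRing B]
    [NonUnitalRing C] [NonUnitalRing D] (p : A →ₙ+* B) (q : C →ₙ+* D)
    (hp : Function.Surjective p) (hq : Function.Surjective q) (f : A ≃+* C)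
    (h : ∀ a, p a = 0 ↔ q (f a) = 0) : ∃ g : B ≃+* D, ∀ a, g (p a) = q (f a) := by
  have h' {a b : A} : p a = p b ↔ q (f a) = q (f b) := by
    rw [← sub_eq_zero, ← map_sub, h, map_sub, map_sub, sub_eq_zero]
  let t := Function.surjInv hp
  have ht (b : B) : p (t b) = b := Function.surjInv_eq hp b
  let g : B →ₙ+* D :=
    { toFun b := q (f (t b))
      map_zero' := by rw [← h, ht]
      map_add' x y := by rw [← map_add, ← map_add, ← h', map_add, ht, ht, ht]
      map_mul' x y := by rw [← map_mul, ← map_mul, ← h', map_mul, ht, ht, ht] }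
  refine ⟨RingEquiv.ofBijective g ⟨fun x y hxy => ?_, fun d => ?_⟩, fun a => h'.1 (ht (p a))⟩
  · rw [← ht x, ← ht y]
    exact h'.2 hxy
  · obtain ⟨c, rfl⟩ := hq d
    obtain ⟨a, rfl⟩ := f.surjective c
    exact ⟨p a, h'.1 (ht (p a))⟩

end Leavitt

/-! ### Point functors and the series -/

namespace PointFunctor

theorem vertexEquiv_mem (H : PointFunctor.{u, v}) {E F : RowFiniteGraph.{u, v}}
    (α : RowFiniteGraph.GraphIso E F) {x : E.Vertex} (hx : x ∈ H.vertices E) :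
    α.vertexEquiv x ∈ H.vertices F :=
  H.map (V := F) (U := E) α hx

theorem vertexEquiv_mem_iff (H : PointFunctor.{u, v}) {E F : RowFiniteGraph.{u, v}}
    (α : RowFiniteGraph.GraphIso E F) (x : E.Vertex) :
    x ∈ H.vertices E ↔ α.vertexEquiv x ∈ H.vertices F := by
  refine ⟨H.vertexEquiv_mem α, fun h => ?_⟩
  have := H.vertexEquiv_mem α.symm h
  rwa [show α.symm.vertexEquiv = α.vertexEquiv.symm from rfl, Equiv.symm_apply_apply] at this

theorem IsInvariant.mem_iff {K : Type w} [Field K] {H : PointFunctor.{u, v}}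
    (hH : H.IsInvariant K) {E F : RowFiniteGraph.{u, v}} (f : Leavitt K E ≃+* Leavitt K F)
    (a : Leavitt K E) :
    f a ∈ Leavitt.idealOf K (H.vertices F) ↔ a ∈ Leavitt.idealOf K (H.vertices E) := by
  rw [← SetLike.mem_coe, ← hH E F f, f.injective.mem_set_image, SetLike.mem_coe]

end PointFunctor

namespace HSPointFunctor

theorem ext_vertices {H T : HSPointFunctor.{u, v}} (h : ∀ E, H.vertices E = T.vertices E) :
    H = T := by
  obtain ⟨H, _, _⟩ := H
  obtain ⟨T, _, _⟩ := T
  obtain rfl : H = T := Subfunctor.ext (funext h)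
  rfl

/-- The hereditary saturated point functor `E ↦ T(E) ∪ H(E / T(E))`. -/
def extend (H T : HSPointFunctor.{u, v}) : HSPointFunctor.{u, v} where
  toPointFunctor :=
    { obj E := T.vertices E ∪ Subtype.val '' H.vertices (E.quotient (T.vertices E))
      map := by
        rintro E F α x (hx | ⟨z, hz, rfl⟩)
        · exact .inl (T.toPointFunctor.vertexEquiv_mem α hx)
        · exact .inr ⟨_, H.toPointFunctor.vertexEquiv_mem
            (α.quotient (T.toPointFunctor.vertexEquiv_mem_iff α)) hz, rfl⟩ }
  hereditary E := (T.hereditary E).union_image_quotient (H.hereditary _)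
  saturated E := (T.saturated E).union_image_quotient (T.hereditary E) (H.saturated _)

theorem isSeries_iff (K : Type w) [Field K] (H : HSPointFunctor.{u, v})
    (S : ℕ+ → HSPointFunctor.{u, v}) :
    H.IsSeries K S ↔ S 1 = H ∧ ∀ n, S (n + 1) = H.extend (S n) := by
  have key (n : ℕ+) (E : RowFiniteGraph.{u, v}) :=
    Leavitt.idealOf_le_and_image_eq_iff (K := K) ((S n).hereditary E) ((S n).saturated E)
      ((S (n + 1)).hereditary E) ((S (n + 1)).saturated E) (H.hereditary _) (H.saturated _)
  constructor
  · intro h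
    exact ⟨h.one, fun n => ext_vertices fun E => (key n E).1 ⟨h.ideal_le n E, h.ideal_eq n E⟩⟩
  · rintro ⟨h₁, h⟩
    have h' (n E) := (key n E).2 (congrArg (fun T => vertices T E) (h n))
    exact ⟨h₁, fun n E => (h' n E).1, fun n E => (h' n E).2⟩

theorem existsUnique_isSeries (K : Type w) [Field K] (H : HSPointFunctor.{u, v}) :
    ∃! S : ℕ+ → HSPointFunctor.{u, v}, H.IsSeries K S := by
  simp only [isSeries_iff]
  refine ⟨fun n => PNat.recOn n H fun _ T => H.extend T,
    ⟨PNat.recOn_one _ _, fun n => PNat.recOn_succ _ _ _⟩, fun S hS => funext fun n => ?_⟩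
  induction n using PNat.recOn with
  | one => rw [hS.1, PNat.recOn_one]
  | succ n ih => rw [hS.2, PNat.recOn_succ, ih]

/-- An isomorphism `L_K(E) ≅ L_K(F)` matching the ideals of the `n`-th terms descends to the
Leavitt path algebras of the quotient graphs, where the invariance of `H` applies; pulling back
gives the ideals of the next terms. -/
theorem IsSeries.isInvariant {K : Type w} [Field K] {H : HSPointFunctor.{u, v}}
    {S : ℕ+ → HSPointFunctor.{u, v}} (hS : H.IsSeries K S)
    (hH : H.toPointFunctor.IsInvariant K) (n : ℕ+) :
    (S n).toPointFunctor.IsInvariant K := by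
  induction n using PNat.recOn with
  | one => rwa [hS.one]
  | succ n ih =>
    intro E F f
    let p (E : RowFiniteGraph.{u, v}) :
        Leavitt K E →ₙ+* Leavitt K (E.quotient ((S n).vertices E)) :=
      NonUnitalRingHomClass.toNonUnitalRingHom
        (Leavitt.toQuotientGraph K ((S n).hereditary E) ((S n).saturated E))
    have hp (E : RowFiniteGraph.{u, v}) (a : Leavitt K E) :
        a ∈ Leavitt.idealOf K ((S (n + 1)).vertices E) ↔
          p E a ∈ Leavitt.idealOf K (H.vertices (E.quotient ((S n).vertices E))) := by
      rw [Leavitt.mem_idealOf_iff_toQuotientGraph_mem_image ((S n).hereditary E)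
        ((S n).saturated E) (hS.ideal_le n E), ← Leavitt.theta_image_toQuotientRing_image]
      exact iff_of_eq (congrArg (p E a ∈ ·) (hS.ideal_eq n E))
    have hker (a : Leavitt K E) : p E a = 0 ↔ p F (f a) = 0 :=
      (Leavitt.toQuotientGraph_eq_zero ((S n).hereditary E) ((S n).saturated E)).trans
        ((ih.mem_iff f a).symm.trans
          (Leavitt.toQuotientGraph_eq_zero ((S n).hereditary F) ((S n).saturated F)).symm)
    obtain ⟨g, hg⟩ := Leavitt.exists_ringEquiv_of_surjective
      (p E) (p F)
      (Leavitt.toQuotientGraph_surjective ((S n).hereditary E) ((S n).saturated E))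
      (Leavitt.toQuotientGraph_surjective ((S n).hereditary F) ((S n).saturated F)) f hker
    have hf (a : Leavitt K E) : f a ∈ Leavitt.idealOf K ((S (n + 1)).vertices F) ↔
        a ∈ Leavitt.idealOf K ((S (n + 1)).vertices E) := by
      rw [hp, hp]
      refine Iff.trans (iff_of_eq (congrArg (· ∈ _) (hg a).symm)) (hH.mem_iff g _)
    ext c
    obtain ⟨a, rfl⟩ := f.surjective c
    rw [f.injective.mem_set_image]
    exact (hf a).symm

end HSPointFunctor

theorem proposition5p2 (K : Type w) [Field K] (H : HSPointFunctor.{u, v}) :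
    (∃! S : ℕ+ → HSPointFunctor.{u, v}, H.IsSeries K S) ∧
    ∀ S : ℕ+ → HSPointFunctor.{u, v}, H.IsSeries K S →
      (∀ (n : ℕ+) (E : RowFiniteGraph.{u, v}),
        Function.Bijective ((S n).theta K E) ∧ (S n).vertices E ⊆ (S (n + 1)).vertices E) ∧
      (PointFunctor.IsInvariant K H.toPointFunctor →
        ∀ n : ℕ+, PointFunctor.IsInvariant K (S n).toPointFunctor) := by
  refine ⟨H.existsUnique_isSeries K, fun S hS => ⟨fun n E => ⟨Leavitt.theta_bijective _ _, ?_⟩,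
    hS.isInvariant⟩⟩
  exact (Leavitt.idealOf_le_idealOf_iff ((S (n + 1)).hereditary E)
    ((S (n + 1)).saturated E)).1 (hS.ideal_le n E)
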